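/- Let $K=\mathbb{Q}(\sqrt{-3})$, $\omega=\frac{1+\sqrt{-3}}{2}$, $\mathcal{O}_K=\mathbb{Z}[\omega]$ its ring of integers, and $\mu_6=\mathcal{O}_K^*=\{\zeta : \zeta^6=1\}$. For $n\in\{3,6\}$, a prime ideal $\mathfrak{p}$ of $\mathcal{O}_K$ prime to $6$ and $\alpha\in\mathcal{O}_K\setminus\mathfrak{p}$, let $\left(\frac{\alpha}{\mathfrak{p}}\right)_n$ be the unique $n$-th root of unity in $\mathcal{O}_K$ congruent to $\alpha^{(\mathrm{N}\mathfrak{p}-1)/n}$ modulo $\mathfrak{p}$. For an integer $k$ prime to $6$ and $\alpha$ prime to $k$, let $\left(\frac{\alpha}{k}\right)_n$ be the product of the $\left(\frac{\alpha}{\mathfrak{p}}\right)_n$ over the prime ideals $\mathfrak{p}$ in the factorization of $k\mathcal{O}_K$, with multiplicity; it depends only on $\alpha$ modulo $k$. For $S\subset\mu_6$ define $$M_k^{[1]}(S,1)=\left\{\lambda\in\mathcal{O}_K/k\mathcal{O}_K : \lambda(1-\lambda)\text{ is a unit},\ \left(\frac{\lambda}{k}\right)_6\in S,\ \left(\frac{\lambda(1-\lambda)}{k}\right)_3=1\right\}.$$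 Let $k\ge5$ be a rational prime. If $k\equiv1\pmod 3$ (so $k$ splits in $K$), then (a) $\#M_k^{[1]}(\{\omega,\omega^5\},1)=\frac19(k-1)^2$; (b) $\#M_k^{[1]}(\{\omega,\omega^3,\omega^5\},1)=\frac16(k-1)(k-3)$; (c) $\#M_k^{[1]}(\{\omega,\omega^2,\omega^4,\omega^5\},1)=\frac29(k-1)^2$; (d) $\#M_k^{[1]}(\mu_6,1)=\frac13(k^2-2k+4)$. If $k\equiv2\pmod 3$ (so $k$ is inert in $K$), then (a) $\#M_k^{[1]}(\{\omega,\omega^5\},1)=\frac19(k+1)^2$; (b) $\#M_k^{[1]}(\{\omega,\omega^3,\omega^5\},1)=\frac16(k^2-1)$; (c) $\#M_k^{[1]}(\{\omega,\omega^2,\omega^4,\omega^5\},1)=\frac29(k+1)^2$; (d) $\#M_k^{[1]}(\mu_6,1)=\frac13(k^2+2k-2)$. -/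

import Mathlib

noncomputable section

namespace SexticCount

open scoped NumberField
open UniqueFactorizationMonoid

section General

variable {F : Type*} [Field F] [NumberField F]

/-- The `n`-th power residue symbol `(α / 𝔭)_n` at a prime ideal `𝔭` of `𝓞 F`: the `n`-th root of
unity `ζ` of `𝓞 F` with `ζ ≡ α ^ ((N 𝔭 - 1) / n) (mod 𝔭)`. It is used for `𝔭` prime to `n` and `F`
containing the `n`-th roots of unity; then `ζ` exists and is unique for `α ∉ 𝔭`, and the symbol
is `0` for `α ∈ 𝔭`. -/
def primeResidueSymbol (n : ℕ) (α : 𝓞 F) (𝔭 : Ideal (𝓞 F)) : 𝓞 F :=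
  open Classical in
  if h : ∃ ζ : 𝓞 F, ζ ^ n = 1 ∧
      (Ideal.Quotient.mk 𝔭 ζ) = (Ideal.Quotient.mk 𝔭 α) ^ ((Ideal.absNorm 𝔭 - 1) / n)
  then h.choose else 0

/-- The `n`-th power residue symbol `(α / 𝔎)_n` for an ideal `𝔎`: the product of the symbols at the
prime ideals in the factorization of `𝔎`, with multiplicity. -/
def residueSymbol (n : ℕ) (α : 𝓞 F) (𝔎 : Ideal (𝓞 F)) : 𝓞 F :=
  ((normalizedFactors 𝔎).map (primeResidueSymbol n α)).prod

/-- The residue symbol depends only on the class of `α` modulo `𝔎`. -/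
theorem residueSymbol_congr (n : ℕ) (𝔎 : Ideal (𝓞 F)) {α β : 𝓞 F}
    (h : Ideal.Quotient.mk 𝔎 α = Ideal.Quotient.mk 𝔎 β) :
    residueSymbol n α 𝔎 = residueSymbol n β 𝔎 := by
  unfold residueSymbol
  congr 1
  refine Multiset.map_congr rfl fun 𝔭 h𝔭 => ?_
  have hle : 𝔎 ≤ 𝔭 := Ideal.dvd_iff_le.mp (dvd_of_mem_normalizedFactors h𝔭)
  have hp : Ideal.Quotient.mk 𝔭 α = Ideal.Quotient.mk 𝔭 β :=
    Ideal.Quotient.eq.mpr (hle (Ideal.Quotient.eq.mp h))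
  unfold primeResidueSymbol
  rw [hp]

/-- The `n`-th power residue symbol of a residue class `l ∈ 𝓞 F / 𝔎`. -/
def classSymbol (n : ℕ) (𝔎 : Ideal (𝓞 F)) (l : 𝓞 F ⧸ 𝔎) : 𝓞 F :=
  Quotient.liftOn' l (fun α => residueSymbol n α 𝔎)
    (fun _ _ h => residueSymbol_congr n 𝔎 (Quotient.sound' h))

theorem classSymbol_mk (n : ℕ) (𝔎 : Ideal (𝓞 F)) (α : 𝓞 F) :
    classSymbol n 𝔎 (Ideal.Quotient.mk 𝔎 α) = residueSymbol n α 𝔎 := rfl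

/-- The classes `l` modulo `𝔎` with `gcd (l (1 - l), 𝔎) = 1`, that is, `l (1 - l)` invertible
modulo `𝔎`. -/
def sharpClasses (𝔎 : Ideal (𝓞 F)) : Set (𝓞 F ⧸ 𝔎) :=
  {l | IsUnit (l * (1 - l))}

/-- `M_𝔎(ζ)`: the classes in `sharpClasses 𝔎` with sextic residue symbol `ζ`. -/
def sexticClass (𝔎 : Ideal (𝓞 F)) (ζ : 𝓞 F) : Set (𝓞 F ⧸ 𝔎) :=
  {l ∈ sharpClasses 𝔎 | classSymbol 6 𝔎 l = ζ}

/-- `M_𝔎^[1](ζ, ξ)`: the classes `l` in `M_𝔎(ζ)` such that `l (1 - l)` has cubic residue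
symbol `ξ`. -/
def typeOneClass (𝔎 : Ideal (𝓞 F)) (ζ ξ : 𝓞 F) : Set (𝓞 F ⧸ 𝔎) :=
  {l ∈ sexticClass 𝔎 ζ | classSymbol 3 𝔎 (l * (1 - l)) = ξ}

/-- `M_𝔎^[1](S, ξ)`: the union of the `M_𝔎^[1](ζ, ξ)` for `ζ ∈ S`. -/
def typeOneSet (𝔎 : Ideal (𝓞 F)) (S : Set (𝓞 F)) (ξ : 𝓞 F) : Set (𝓞 F ⧸ 𝔎) :=
  ⋃ ζ ∈ S, typeOneClass 𝔎 ζ ξ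

end General

open IntermediateField

/-- The complex number `√-3`. -/
def sqrtNegThree : ℂ := (Real.sqrt 3 : ℂ) * Complex.I

theorem sqrtNegThree_sq : sqrtNegThree ^ 2 = -3 := by
  unfold sqrtNegThree
  rw [mul_pow, Complex.I_sq, ← Complex.ofReal_pow, Real.sq_sqrt (by norm_num)]
  norm_num

/-- The field `K = ℚ(√-3)`, inside `ℂ`. -/
abbrev K : IntermediateField ℚ ℂ := ℚ⟮sqrtNegThree⟯

instance : NumberField K where
  to_charZero := inferInstance
  to_finiteDimensional := by
    refine IntermediateField.adjoin.finiteDimensional ?_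
    exact ⟨Polynomial.X ^ 2 + Polynomial.C 3, by monicity!,
      by simp [sqrtNegThree_sq]⟩

/-- `√-3` as an element of `K`. -/
def rootK : K := ⟨sqrtNegThree, mem_adjoin_simple_self ℚ sqrtNegThree⟩

theorem rootK_sq : rootK ^ 2 = -3 :=
  by
  apply Subtype.ext
  change sqrtNegThree ^ 2 = ((-3 : K) : ℂ)
  rw [sqrtNegThree_sq]
  push_cast
  rfl

/-- `ω = (1 + √-3) / 2`, a primitive sixth root of unity, as an element of the ring of integers
of `K`. -/
def omega : 𝓞 K :=
  ⟨(1 + rootK) / 2, ⟨Polynomial.X ^ 2 - Polynomial.X + 1, by monicity!, by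
    simp only [Polynomial.eval₂_add, Polynomial.eval₂_sub, Polynomial.eval₂_pow,
      Polynomial.eval₂_X, Polynomial.eval₂_one]
    linear_combination (1 / 4 : K) * rootK_sq⟩⟩

/-- The ideal `k 𝓞_K`. -/
def principal (k : ℤ) : Ideal (𝓞 K) := Ideal.span {(k : 𝓞 K)}

/-- The group `μ_6` of sixth roots of unity, as a set of elements of `𝓞 K`. -/
def muSix : Set (𝓞 K) := {ζ | ζ ^ 6 = 1}

/-- `#M_k^[1](S, 1)`. -/
def countTypeOne (k : ℤ) (S : Set (𝓞 K)) : ℕ := (typeOneSet (principal k) S 1).ncard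

end SexticCount

end

/-! Write `p` for the prime `k` and `R = 𝓞 K ⧸ (p)`, an `𝔽_p`-algebra of order `p ^ 2`. The sextic
symbol is a character `X` of `R` of exact order 6 that is trivial on `𝔽_pˣ`. The cubic symbol is its
square, so orthogonality (`characterCount_eq_sum`) expresses each count through the eighteen Jacobi
sums `J(X^(a+2b), X^(2b))`.

Triviality on `𝔽_pˣ` makes these sums elementary. The sum of such a character `B` over a coset `w +
𝔽_p` is unchanged when `w` is translated by `𝔽_p` or scaled by `𝔽_pˣ`. As `R = 𝔽_p w + 𝔽_p` for
every `w` outside `𝔽_p`, the coset sum takes one value on `𝔽_p` and one value off it. Evaluating `∑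
A(u) (∑_t B(u + t))` in two ways then gives `J(A, B)` in closed form (`jacobiSum_eq`).

The splitting of `p` enters only through `#Rˣ = (p - 1)(p - e)`, with `e = 1` for split and `e = -1`
for inert `p`. The Jacobi sum is `(p-e-1)^2 + e - 1` if `A = B = 1`, `e` if exactly one of `A`, `B`,
`AB` is trivial, and `p` if none is. Hence `characterCount_eq` and, on summing over the symbols,
`countTypeOne_eq`. -/

namespace SexticCount

set_option linter.unusedSectionVars false

/-! ### Jacobi sums of characters trivial on the prime field -/

section CharacterSums

variable {p : ℕ} [Fact p.Prime] {R : Type*} [CommRing R] [Fintype R] [Algebra (ZMod p) R]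
  {D : Type*} [CommRing D]

open Finset

/-- A multiplicative character of an `𝔽_p`-algebra that is trivial on `𝔽_pˣ`. -/
def TrivialOnPrimeField (p : ℕ) [Fact p.Prime] [Algebra (ZMod p) R] (A : MulChar R D) : Prop :=
  ∀ t : ZMod p, t ≠ 0 → A (algebraMap (ZMod p) R t) = 1

theorem TrivialOnPrimeField.pow {A : MulChar R D} (hA : TrivialOnPrimeField p A) (n : ℕ) :
    TrivialOnPrimeField p (A ^ n) := by
  intro t ht
  have hu : IsUnit (algebraMap (ZMod p) R t) := (IsUnit.mk0 t ht).map _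
  obtain ⟨u, hu⟩ := hu
  rw [← hu, MulChar.pow_apply_coe, hu, hA t ht, one_pow]

theorem TrivialOnPrimeField.map_neg_one {A : MulChar R D} (hA : TrivialOnPrimeField p A) :
    A (-1) = 1 := by
  have := hA (-1) (by simp)
  simpa using this

theorem TrivialOnPrimeField.map_neg {A : MulChar R D} (hA : TrivialOnPrimeField p A) (x : R) :
    A (-x) = A x := by
  rw [neg_eq_neg_one_mul, map_mul, hA.map_neg_one, one_mul]

theorem TrivialOnPrimeField.map_smul {A : MulChar R D} (hA : TrivialOnPrimeField p A)
    {t : ZMod p} (ht : t ≠ 0) (x : R) : A (algebraMap (ZMod p) R t * x) = A x := by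
  rw [map_mul, hA t ht, one_mul]

theorem sum_zmod_eq [Nontrivial R] {A : MulChar R D} (hA : TrivialOnPrimeField p A) :
    ∑ t : ZMod p, A (algebraMap (ZMod p) R t) = (p : D) - 1 := by
  have hp : p.Prime := Fact.out
  rw [← Finset.add_sum_erase _ _ (mem_univ (0 : ZMod p)), map_zero, MulChar.map_zero, zero_add,
    Finset.sum_congr rfl (fun t ht => hA t (ne_of_mem_erase ht))]
  simp [Finset.card_erase_of_mem, ZMod.card, Nat.cast_sub hp.one_le]

/-- The sum of `A` over the coset `w + 𝔽_p`. -/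
def cosetSum (p : ℕ) [Fact p.Prime] [Algebra (ZMod p) R] (A : MulChar R D) (w : R) : D :=
  ∑ t : ZMod p, A (w + algebraMap (ZMod p) R t)

theorem cosetSum_add (A : MulChar R D) (w : R) (s : ZMod p) :
    cosetSum p A (w + algebraMap (ZMod p) R s) = cosetSum p A w := by
  unfold cosetSum
  rw [← Equiv.sum_comp (Equiv.addLeft s) (fun t => A (w + algebraMap (ZMod p) R t))]
  simp [add_assoc]

theorem cosetSum_mul {A : MulChar R D} (hA : TrivialOnPrimeField p A) (w : R) {s : ZMod p}
    (hs : s ≠ 0) : cosetSum p A (algebraMap (ZMod p) R s * w) = cosetSum p A w := by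
  unfold cosetSum
  rw [← Equiv.sum_comp (Equiv.mulLeft₀ s hs)
    (fun t => A (algebraMap (ZMod p) R s * w + algebraMap (ZMod p) R t))]
  refine sum_congr rfl fun t _ => ?_
  rw [Equiv.mulLeft₀_apply, map_mul, ← mul_add, hA.map_smul hs]

theorem cosetSum_neg {A : MulChar R D} (hA : TrivialOnPrimeField p A) (w : R) :
    cosetSum p A (-w) = cosetSum p A w := by
  simpa using cosetSum_mul hA w (s := -1) (by simp)

theorem cosetSum_algebraMap [Nontrivial R] {A : MulChar R D} (hA : TrivialOnPrimeField p A)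
    (s : ZMod p) : cosetSum p A (algebraMap (ZMod p) R s) = (p : D) - 1 := by
  have := cosetSum_add (p := p) A 0 s
  rw [zero_add] at this
  rw [this, cosetSum]
  simpa using sum_zmod_eq hA

/-- A relation between `w` and `1` with nonzero coefficient at `w` would put `w` in `𝔽_p`; so the
map is injective, and it is onto by counting. No field structure on `R` is needed, which lets the
split case through. -/
theorem exists_eq_add_mul (hcard : Fintype.card R = p ^ 2) {w : R}
    (hw : w ∉ Set.range (algebraMap (ZMod p) R)) (x : R) :
    ∃ s t : ZMod p, x = algebraMap (ZMod p) R s * w + algebraMap (ZMod p) R t := by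
  have hp : p.Prime := Fact.out
  have : Nontrivial R := Fintype.one_lt_card_iff_nontrivial.mp
    (by rw [hcard]; exact Nat.one_lt_pow two_ne_zero hp.one_lt)
  have hinj : Function.Injective (fun st : ZMod p × ZMod p =>
      algebraMap (ZMod p) R st.1 * w + algebraMap (ZMod p) R st.2) := by
    rintro ⟨s, t⟩ ⟨s', t'⟩ h
    simp only at h
    have h1 : algebraMap (ZMod p) R (s - s') * w = algebraMap (ZMod p) R (t' - t) := by
      rw [map_sub, map_sub]; linear_combination h
    by_cases hs : s - s' = 0
    · rw [hs, map_zero, zero_mul] at h1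
      have h2 : t' - t = 0 := (algebraMap (ZMod p) R).injective (by rw [← h1, map_zero])
      rw [sub_eq_zero.mp hs, sub_eq_zero.mp h2]
    · refine absurd ⟨(s - s')⁻¹ * (t' - t), ?_⟩ hw
      rw [map_mul, ← h1, ← mul_assoc, ← map_mul, inv_mul_cancel₀ hs, map_one, one_mul]
  have hbij := (Fintype.bijective_iff_injective_and_card _).mpr
    ⟨hinj, by rw [Fintype.card_prod, ZMod.card, hcard, sq]⟩
  obtain ⟨⟨s, t⟩, h⟩ := hbij.2 x
  exact ⟨s, t, h.symm⟩

theorem cosetSum_eq_of_notMem_range (hcard : Fintype.card R = p ^ 2) {A : MulChar R D}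
    (hA : TrivialOnPrimeField p A) {w x : R}
    (hw : w ∉ Set.range (algebraMap (ZMod p) R)) (hx : x ∉ Set.range (algebraMap (ZMod p) R)) :
    cosetSum p A x = cosetSum p A w := by
  obtain ⟨s, t, rfl⟩ := exists_eq_add_mul hcard hw x
  have hs : s ≠ 0 := by
    rintro rfl
    exact hx ⟨t, by simp⟩
  rw [cosetSum_add, cosetSum_mul hA w hs]

theorem sum_cosetSum (A : MulChar R D) : ∑ w : R, cosetSum p A w = p * ∑ x : R, A x := by
  unfold cosetSum
  have h : ∀ t : ZMod p, ∑ w : R, A (w + algebraMap (ZMod p) R t) = ∑ x : R, A x := fun t =>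
    Equiv.sum_comp (Equiv.addRight (algebraMap (ZMod p) R t)) (fun x => A x)
  rw [sum_comm, Finset.sum_congr rfl (fun t _ => h t)]
  simp [ZMod.card]


theorem nontrivial_of_card (hcard : Fintype.card R = p ^ 2) : Nontrivial R :=
  Fintype.one_lt_card_iff_nontrivial.mp
    (by rw [hcard]; exact Nat.one_lt_pow two_ne_zero (Fact.out : p.Prime).one_lt)

theorem exists_notMem_range (hcard : Fintype.card R = p ^ 2) :
    ∃ w : R, w ∉ Set.range (algebraMap (ZMod p) R) := by
  by_contra! h
  have h1 := Fintype.card_le_of_surjective (algebraMap (ZMod p) R) (fun x => h x)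
  rw [hcard, ZMod.card, sq] at h1
  have := (Fact.out : p.Prime).two_le
  nlinarith

theorem sum_mul_of_const_off_range [Nontrivial R] (f g : R → D) (c b : D)
    (hc : ∀ t : ZMod p, g (algebraMap (ZMod p) R t) = c)
    (hb : ∀ x, x ∉ Set.range (algebraMap (ZMod p) R) → g x = b) :
    ∑ x, f x * g x = b * ∑ x, f x + (c - b) * ∑ t : ZMod p, f (algebraMap (ZMod p) R t) := by
  have h : ∑ t : ZMod p, f (algebraMap (ZMod p) R t) * (c - b) = ∑ x, f x * (g x - b) := by
    refine sum_of_injOn (algebraMap (ZMod p) R) (algebraMap (ZMod p) R).injective.injOn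
      (fun _ _ => mem_coe.mpr (mem_univ _)) (fun x _ hx => ?_) (fun t _ => by rw [hc])
    rw [hb x (by simpa using hx), sub_self, mul_zero]
  have h2 : ∑ x, f x * g x = ∑ x, f x * (g x - b) + b * ∑ x, f x := by
    rw [mul_sum, ← sum_add_distrib]
    exact sum_congr rfl fun x _ => by ring
  rw [h2, ← h, ← sum_mul]
  ring

theorem sum_mul_sub_eq {A B : MulChar R D} (hA : TrivialOnPrimeField p A)
    (hB : TrivialOnPrimeField p B) {t : ZMod p} (ht : t ≠ 0) :
    ∑ u, A u * B (algebraMap (ZMod p) R t - u) = jacobiSum A B := by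
  have hu : IsUnit (algebraMap (ZMod p) R t) := (IsUnit.mk0 t ht).map _
  obtain ⟨v, hv⟩ := hu
  rw [jacobiSum, ← Equiv.sum_comp (Units.mulLeft v)]
  refine sum_congr rfl fun x _ => ?_
  rw [Units.mulLeft_apply, hv, hA.map_smul ht, ← hB.map_smul ht (1 - x), mul_sub, mul_one]

/-- Since `B` is even, the left side is the sum over `t` of `∑ A(u) B(t - u)`. Substituting `u = t
x` turns each of the `p - 1` terms with `t ≠ 0` into the Jacobi sum; `t = 0` leaves `∑ A(u) B(u)`.
-/
theorem sum_mul_cosetSum_eq {A B : MulChar R D} (hA : TrivialOnPrimeField p A)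
    (hB : TrivialOnPrimeField p B) :
    ∑ u, A u * cosetSum p B u = ((p : D) - 1) * jacobiSum A B + ∑ u, (A * B) u := by
  have hp : p.Prime := Fact.out
  have h1 : ∑ u, A u * cosetSum p B u =
      ∑ t : ZMod p, ∑ u, A u * B (algebraMap (ZMod p) R t - u) := by
    rw [sum_comm]
    refine sum_congr rfl fun u _ => ?_
    rw [← cosetSum_neg hB, cosetSum, mul_sum]
    exact sum_congr rfl fun t _ => by rw [neg_add_eq_sub]
  rw [h1, ← Finset.add_sum_erase _ _ (mem_univ (0 : ZMod p)),
    Finset.sum_congr rfl (fun t ht => sum_mul_sub_eq hA hB (ne_of_mem_erase ht)), add_comm]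
  congr 1
  · simp [Finset.card_erase_of_mem, ZMod.card, Nat.cast_sub hp.one_le]
  · exact sum_congr rfl fun u _ => by
      rw [map_zero, zero_sub, hB.map_neg, MulChar.mul_apply]

variable [IsDomain D] [CharZero D]

/-- The Jacobi sum of two characters that are trivial on `𝔽_pˣ`, in terms of the character sums. -/
theorem jacobiSum_of_trivialOnPrimeField (hcard : Fintype.card R = p ^ 2) {A B : MulChar R D}
    (hA : TrivialOnPrimeField p A) (hB : TrivialOnPrimeField p B) :
    ((p : D) - 1) * (((p : D) - 1) * jacobiSum A B + ∑ u, (A * B) u) =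
      ((p : D) - 1) ^ 3 + (∑ u, A u - ((p : D) - 1)) * (∑ u, B u - ((p : D) - 1)) := by
  have hp : p.Prime := Fact.out
  have hp0 : (p : D) ≠ 0 := Nat.cast_ne_zero.mpr hp.ne_zero
  have := nontrivial_of_card hcard
  obtain ⟨w, hw⟩ := exists_notMem_range hcard
  have key := fun f : R → D => sum_mul_of_const_off_range (p := p) f (cosetSum p B) _ _
    (cosetSum_algebraMap hB) (fun x hx => cosetSum_eq_of_notMem_range hcard hB hw hx)
  -- The constant weight determines the unknown value of the coset sum off `𝔽_p`; the weight `A`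
  -- gives the second evaluation of the double sum.
  have h1 := key (fun _ => 1)
  have h2 := key A
  rw [sum_mul_cosetSum_eq hA hB, sum_zmod_eq hA] at h2
  simp only [one_mul, sum_cosetSum, sum_const, card_univ, hcard, ZMod.card, nsmul_eq_mul,
    mul_one] at h1
  push_cast at h1
  have h3 : ∑ u, B u = (p - 1) + (p - 1) * cosetSum p B w := by
    apply mul_left_cancel₀ hp0
    linear_combination h1
  rw [h2, h3]
  ring

omit [Algebra (ZMod p) R] [Fact p.Prime] [CharZero D] in
theorem sum_mulChar_eq [DecidableEq (MulChar R D)] {q : D} (hq : (Nat.card Rˣ : D) = q)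
    (A : MulChar R D) : ∑ u, A u = if A = 1 then q else 0 := by
  classical
  split_ifs with h
  · rw [h, MulChar.sum_one_eq_card_units, ← hq, Nat.card_eq_fintype_card]
  · exact MulChar.sum_eq_zero_of_ne_one h

/-- A complete character sum is `#Rˣ = (p - 1)(p - e)` or `0`, so a factor `(p - 1) ^ 2` cancels
from `jacobiSum_of_trivialOnPrimeField`. -/
theorem jacobiSum_eq [DecidableEq (MulChar R D)] (hcard : Fintype.card R = p ^ 2) {e : D}
    (he : (Nat.card Rˣ : D) = ((p : D) - 1) * (p - e)) {A B : MulChar R D}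
    (hA : TrivialOnPrimeField p A) (hB : TrivialOnPrimeField p B) :
    jacobiSum A B = ((p : D) - 1)
      + ((p - e) * (if A = 1 then 1 else 0) - 1) * ((p - e) * (if B = 1 then 1 else 0) - 1)
      - (p - e) * (if A * B = 1 then 1 else 0) := by
  have hp : p.Prime := Fact.out
  have hp1 : ((p : D) - 1) ≠ 0 := sub_ne_zero.mpr (by exact_mod_cast hp.one_lt.ne')
  have h := jacobiSum_of_trivialOnPrimeField hcard hA hB
  have h1 : ∀ C : MulChar R D, ∑ u, C u = ((p : D) - 1) * ((p - e) * if C = 1 then 1 else 0) := by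
    intro C
    rw [sum_mulChar_eq he]
    split_ifs <;> ring
  rw [h1, h1, h1] at h
  apply mul_left_cancel₀ hp1
  apply mul_left_cancel₀ hp1
  linear_combination h

end CharacterSums

/-! ### Counting by orthogonality of characters -/

section Counting

open Finset

variable {D : Type*} [CommRing D] [IsDomain D]

theorem sum_pow_eq_ite [DecidableEq D] {n : ℕ} {z : D} (hz : z ^ n = 1) :
    ∑ a ∈ range n, z ^ a = if z = 1 then (n : D) else 0 := by
  split_ifs with h
  · simp [h]
  · have := mul_geom_sum z n
    rw [hz, sub_self] at this
    exact (mul_eq_zero.mp this).resolve_left (sub_ne_zero.mpr h)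

variable {R : Type*} [CommRing R] [Fintype R]

/-- The number of `x` with `x (1 - x)` a unit, `X x = ζ` and `X (x (1 - x)) ^ 2 = 1`. -/
noncomputable def characterCount (X : MulChar R D) (ζ : D) : ℕ :=
  Nat.card {x : R // IsUnit (x * (1 - x)) ∧ X x = ζ ∧ X (x * (1 - x)) ^ 2 = 1}

/-- The geometric sums of `ξ X(x)` over `a < 6` and of `X(x(1-x))^2` over `b < 3` detect the two
conditions, with total weight `6 * 3 = 18`. -/
theorem characterCount_eq_sum {X : MulChar R D} (hX : X ^ 6 = 1) {ζ ξ : D} (hζ : ζ ^ 6 = 1)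
    (hξ : ζ * ξ = 1) :
    18 * (characterCount X ζ : D) =
      ∑ a ∈ range 6, ∑ b ∈ range 3, ξ ^ a * jacobiSum (X ^ (a + 2 * b)) (X ^ (2 * b)) := by
  classical
  have h6 : ∀ u : R, IsUnit u → X u ^ 6 = 1 := by
    rintro _ ⟨u, rfl⟩
    rw [← MulChar.pow_apply_coe, hX, MulChar.one_apply_coe]
  have hξ6 : ξ ^ 6 = 1 := by
    have : (ζ * ξ) ^ 6 = 1 := by rw [hξ, one_pow]
    rwa [mul_pow, hζ, one_mul] at this
  have key : ∀ x : R, ∑ a ∈ range 6, ∑ b ∈ range 3,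
      ξ ^ a * ((X ^ (a + 2 * b)) x * (X ^ (2 * b)) (1 - x)) =
      18 * if IsUnit (x * (1 - x)) ∧ X x = ζ ∧ X (x * (1 - x)) ^ 2 = 1 then 1 else 0 := by
    intro x
    by_cases hx : IsUnit (x * (1 - x))
    · obtain ⟨⟨u, hu⟩, ⟨v, hv⟩⟩ := IsUnit.mul_iff.mp hx
      have e1 : ∀ a b : ℕ, ξ ^ a * ((X ^ (a + 2 * b)) x * (X ^ (2 * b)) (1 - x)) =
          (ξ * X x) ^ a * (X (x * (1 - x)) ^ 2) ^ b := by
        intro a b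
        rw [map_mul, ← hv, ← hu, MulChar.pow_apply_coe, MulChar.pow_apply_coe]
        ring
      simp only [e1, ← mul_sum, ← sum_mul]
      rw [sum_pow_eq_ite (by rw [mul_pow, hξ6, h6 x ⟨u, hu⟩, one_mul]),
        sum_pow_eq_ite (by rw [← pow_mul]; exact h6 _ hx)]
      have e2 : ξ * X x = 1 ↔ X x = ζ := by
        constructor
        · intro h; linear_combination ζ * h - X x * hξ
        · intro h; rw [h, mul_comm, hξ]
      simp only [e2, hx, true_and]
      split_ifs <;> first | (exfalso; tauto) | norm_num
    · rw [if_neg (fun h => hx h.1), mul_zero]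
      refine sum_eq_zero fun a _ => sum_eq_zero fun b _ => ?_
      -- Characters vanish at nonunits, and so does the trivial character `X ^ 0`; hence no term
      -- survives, not even those with `a = b = 0`.
      by_cases h1 : IsUnit x
      · rw [MulChar.map_nonunit (X ^ (2 * b)) (fun h2 => hx (h1.mul h2)), mul_zero, mul_zero]
      · rw [MulChar.map_nonunit _ h1, zero_mul, mul_zero]
  simp only [jacobiSum, mul_sum]
  have : ∑ a ∈ range 6, ∑ b ∈ range 3, ∑ x : R,
      ξ ^ a * ((X ^ (a + 2 * b)) x * (X ^ (2 * b)) (1 - x)) =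
      ∑ x : R, ∑ a ∈ range 6, ∑ b ∈ range 3,
      ξ ^ a * ((X ^ (a + 2 * b)) x * (X ^ (2 * b)) (1 - x)) := by
    rw [eq_comm, sum_comm]
    exact sum_congr rfl fun a _ => sum_comm
  rw [this, sum_congr rfl fun x _ => key x, ← mul_sum, characterCount, Nat.card_eq_fintype_card,
    Fintype.card_subtype, ← sum_boole]

variable {p : ℕ} [Fact p.Prime] [Algebra (ZMod p) R] [CharZero D]

theorem characterCount_eq (hcard : Fintype.card R = p ^ 2) {e : D}
    (he : (Nat.card Rˣ : D) = ((p : D) - 1) * (p - e)) {X : MulChar R D}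
    (hX : TrivialOnPrimeField p X) (hX6 : X ^ 6 = 1) {w : D} (hw : IsPrimitiveRoot w 6)
    (hXw : ∃ x, X x = w) {ζ ξ : D} (hζ : ζ ^ 6 = 1) (hξ : ζ * ξ = 1) :
    18 * (characterCount X ζ : D) = ((p - e - 1) ^ 2 + e - 1 + 2 * p)
      + (ξ + ξ ^ 3 + ξ ^ 5) * (e + 2 * p) + (ξ ^ 2 + ξ ^ 4) * (3 * e) := by
  classical
  -- A primitive sixth root of unity is a value of `X`, so `X` has exact order 6 and the triviality
  -- of each power in the Jacobi sums is decided by divisibility.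
  have hone : ∀ m : ℕ, X ^ m = 1 ↔ 6 ∣ m := by
    intro m
    constructor
    · intro h
      obtain ⟨x, hx⟩ := hXw
      have hu : IsUnit x := by
        by_contra hu
        rw [MulChar.map_nonunit _ hu] at hx
        exact hw.ne_zero (by norm_num) hx.symm
      obtain ⟨u, rfl⟩ := hu
      refine (hw.pow_eq_one_iff_dvd m).mp ?_
      rw [← hx, ← MulChar.pow_apply_coe, h, MulChar.one_apply_coe]
    · rintro ⟨c, rfl⟩
      rw [pow_mul, hX6, one_pow]
  rw [characterCount_eq_sum hX6 hζ hξ]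
  simp only [jacobiSum_eq hcard he (hX.pow _) (hX.pow _), ← pow_add, hone]
  simp only [sum_range_succ, range_zero, sum_empty]
  norm_num
  ring

end Counting
end SexticCount

/-! ### Arithmetic of `ℤ[ω]` -/

namespace SexticCount

open scoped NumberField
open IntermediateField Polynomial

theorem omega_sq : omega ^ 2 = omega - 1 := by
  apply NumberField.RingOfIntegers.ext
  change ((1 + rootK) / 2) ^ 2 = (1 + rootK) / 2 - 1
  linear_combination (1 / 4 : K) * rootK_sq

theorem isPrimitiveRoot_of_sq {D : Type*} [CommRing D] [IsDomain D] (h6 : (6 : D) ≠ 0) {w : D}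
    (hw : w ^ 2 = w - 1) : IsPrimitiveRoot w 6 := by
  have : NeZero ((6 : ℕ) : D) := ⟨by exact_mod_cast h6⟩
  rw [← isRoot_cyclotomic_iff, cyclotomic_six]
  simp [hw]

theorem isPrimitiveRoot_omega : IsPrimitiveRoot omega 6 :=
  isPrimitiveRoot_of_sq (by norm_num) omega_sq

theorem isPrimitiveRoot_coe_omega : IsPrimitiveRoot (omega : K) 6 :=
  isPrimitiveRoot_omega.map_of_injective NumberField.RingOfIntegers.coe_injective

instance : IsCyclotomicExtension {6} ℚ K := by
  rw [IsCyclotomicExtension.iff_singleton]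
  refine ⟨⟨_, isPrimitiveRoot_coe_omega⟩, ?_⟩
  rw [← Algebra.eq_top_iff, ← IntermediateField.adjoin_eq_top_iff, eq_top_iff]
  rintro ⟨x, hx⟩ -
  induction hx using IntermediateField.adjoin_induction with
  | mem x h =>
    obtain rfl := Set.mem_singleton_iff.mp h
    have h1 : (omega : K) ∈ IntermediateField.adjoin ℚ {b : K | b ^ 6 = 1} :=
      subset_adjoin _ _ isPrimitiveRoot_coe_omega.pow_eq_one
    have h2 : rootK = 2 * (omega : K) - 1 := by
      change rootK = 2 * ((1 + rootK) / 2) - 1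
      ring
    change rootK ∈ _
    rw [h2]
    exact sub_mem (mul_mem (ofNat_mem _ 2) h1) (one_mem _)
  | algebraMap q =>
    convert IntermediateField.algebraMap_mem _ q
    change algebraMap ℚ ℂ q = K.val (algebraMap ℚ K q)
    rw [eq_ratCast, eq_ratCast, map_ratCast]
  | add x y hx hy h1 h2 => exact add_mem h1 h2
  | inv x hx h1 => exact inv_mem h1
  | mul x y hx hy h1 h2 => exact mul_mem h1 h2

theorem exists_eq_add_mul_omega (x : 𝓞 K) : ∃ a b : ℤ, x = a + b * omega := by
  obtain ⟨f, hf, rfl⟩ := isPrimitiveRoot_coe_omega.integralPowerBasis.exists_eq_aeval x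
  rw [isPrimitiveRoot_coe_omega.integralPowerBasis_dim,
    show Nat.totient 6 = 2 from by decide] at hf
  obtain ⟨a, b, rfl⟩ := exists_eq_X_add_C_of_natDegree_le_one (Nat.le_of_lt_succ hf)
  refine ⟨b, a, ?_⟩
  rw [isPrimitiveRoot_coe_omega.integralPowerBasis_gen]
  have : isPrimitiveRoot_coe_omega.toInteger = omega := NumberField.RingOfIntegers.ext rfl
  rw [this]
  simp [add_comm]

theorem finrank_ringOfIntegers : Module.finrank ℤ (𝓞 K) = 2 := by
  rw [isPrimitiveRoot_coe_omega.integralPowerBasis.finrank,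
    isPrimitiveRoot_coe_omega.integralPowerBasis_dim]
  decide

/-- Multiplying by the conjugate `a + b - bω` gives the norm form `a^2 + ab + b^2`, which is
positive definite. -/
theorem add_mul_omega_eq_zero {a b : ℤ} (h : (a : 𝓞 K) + b * omega = 0) : b = 0 := by
  have h1 : a ^ 2 + a * b + b ^ 2 = 0 := by
    have : ((a ^ 2 + a * b + b ^ 2 : ℤ) : 𝓞 K) = 0 := by
      push_cast
      linear_combination (a + b - b * omega) * h + (b : 𝓞 K) ^ 2 * omega_sq
    exact_mod_cast this
  nlinarith [sq_nonneg (2 * a + b), sq_nonneg b, pow_eq_zero_iff (two_ne_zero) (a := b)]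

theorem omega_sub_intCast_notMem {p : ℕ} (hp : p.Prime) (r : ℤ) :
    omega - r ∉ principal p := by
  rw [principal, Ideal.mem_span_singleton]
  rintro ⟨γ, hγ⟩
  obtain ⟨a, b, rfl⟩ := exists_eq_add_mul_omega γ
  have h := add_mul_omega_eq_zero (a := -r - p * a) (b := 1 - p * b)
    (by push_cast; push_cast at hγ; linear_combination hγ)
  have h2 : (p : ℤ) ∣ 1 := ⟨b, by linarith⟩
  exact hp.one_lt.ne' (by exact_mod_cast Int.eq_one_of_dvd_one (by positivity) h2)

theorem absNorm_principal (k : ℕ) : Ideal.absNorm (principal k) = k ^ 2 := by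
  have := Ideal.absNorm_span_natCast (S := 𝓞 K) k
  rwa [finrank_ringOfIntegers] at this

end SexticCount

/-! ### Residue symbols at primes not dividing 6 -/

namespace SexticCount

open scoped NumberField
open UniqueFactorizationMonoid

theorem exists_pow_card_sub_one_div_eq {F : Type*} [Field F] [Finite F] {n : ℕ} {ζ : F}
    (hn : n ∣ Nat.card F - 1) (hζ : ζ ^ n = 1) (hn0 : n ≠ 0) :
    ∃ a : F, a ≠ 0 ∧ a ^ ((Nat.card F - 1) / n) = ζ := by
  have hζ0 : ζ ≠ 0 := by
    rintro rfl
    rw [zero_pow hn0] at hζ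
    exact zero_ne_one hζ
  obtain ⟨g, hg⟩ := IsCyclic.exists_generator (α := Fˣ)
  have hg' : ∀ x : Fˣ, x ∈ Submonoid.powers g := fun x =>
    mem_powers_iff_mem_zpowers.mpr (hg x)
  obtain ⟨m, hm⟩ := hg' (Units.mk0 ζ hζ0)
  have hord : orderOf g = Nat.card F - 1 := by
    rw [orderOf_eq_card_of_forall_mem_zpowers hg, Nat.card_units]
  obtain ⟨d, hd⟩ := hn
  have h1 : g ^ (m * n) = 1 := by
    rw [pow_mul]
    simp only at hm
    rw [hm]
    ext
    simpa using hζ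
  have h2 := orderOf_dvd_of_pow_eq_one h1
  rw [hord, hd, mul_comm n d] at h2
  -- With `#Fˣ = d n`, the exponent of `ζ = g ^ m` is a multiple of `d`, so `ζ` is the `d`-th power
  -- of `g ^ j`.
  obtain ⟨j, rfl⟩ := Nat.dvd_of_mul_dvd_mul_right (Nat.pos_of_ne_zero hn0) h2
  refine ⟨((g ^ j : Fˣ) : F), Units.ne_zero _, ?_⟩
  rw [hd, Nat.mul_div_cancel_left _ (Nat.pos_of_ne_zero hn0)]
  have := congrArg Units.val hm
  simp only [Units.val_mk0] at this
  rw [← this, ← Units.val_pow_eq_pow_val, ← pow_mul, mul_comm j d]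

/-- A nonzero prime ideal of `𝓞 K` that does not divide `6`. -/
structure PrimeToSix (𝔭 : Ideal (𝓞 K)) : Prop where
  isPrime : 𝔭.IsPrime
  ne_bot : 𝔭 ≠ ⊥
  six_notMem : (6 : 𝓞 K) ∉ 𝔭

theorem absNorm_eq_card (𝔭 : Ideal (𝓞 K)) : Ideal.absNorm 𝔭 = Nat.card (𝓞 K ⧸ 𝔭) := by
  rw [Ideal.absNorm_apply, Submodule.cardQuot_apply]

namespace PrimeToSix

variable {𝔭 : Ideal (𝓞 K)} (h𝔭 : PrimeToSix 𝔭)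
include h𝔭

theorem isMaximal : 𝔭.IsMaximal := h𝔭.isPrime.isMaximal h𝔭.ne_bot

theorem finite_quotient : Finite (𝓞 K ⧸ 𝔭) := by
  rw [← Ideal.absNorm_ne_zero_iff]
  exact fun h => h𝔭.ne_bot (Ideal.absNorm_eq_zero_iff.mp h)

theorem isPrimitiveRoot_mk : IsPrimitiveRoot (Ideal.Quotient.mk 𝔭 omega) 6 := by
  have := h𝔭.isPrime
  refine isPrimitiveRoot_of_sq (fun h => h𝔭.six_notMem ?_) ?_
  · rw [← Ideal.Quotient.eq_zero_iff_mem, map_ofNat, h]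
  · rw [← map_pow, omega_sq, map_sub, map_one]

theorem pow_absNorm_sub_one {α : 𝓞 K} (hα : α ∉ 𝔭) :
    Ideal.Quotient.mk 𝔭 α ^ (Ideal.absNorm 𝔭 - 1) = 1 := by
  have := h𝔭.isMaximal
  have := h𝔭.finite_quotient
  let := Ideal.Quotient.field 𝔭
  let := Fintype.ofFinite (𝓞 K ⧸ 𝔭)
  rw [absNorm_eq_card, Nat.card_eq_fintype_card]
  exact FiniteField.pow_card_sub_one_eq_one _
    (fun h => hα (Ideal.Quotient.eq_zero_iff_mem.mp h))

theorem omega_notMem : omega ∉ 𝔭 := by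
  intro h
  refine h𝔭.isPrime.one_notMem ?_
  have := Ideal.pow_mem_of_mem 𝔭 h 6 (by norm_num)
  rwa [isPrimitiveRoot_omega.pow_eq_one] at this

/-- The class of `ω` has order 6 in the multiplicative group of the residue field. -/
theorem six_dvd : 6 ∣ Ideal.absNorm 𝔭 - 1 := by
  refine (h𝔭.isPrimitiveRoot_mk.pow_eq_one_iff_dvd _).mp ?_
  exact h𝔭.pow_absNorm_sub_one h𝔭.omega_notMem

/-- Reduction keeps the order of `ω`, so sixth roots of unity stay distinct. This is the uniqueness
that pins down the root chosen in `primeResidueSymbol`. -/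
theorem eq_of_mk_eq {ζ ξ : 𝓞 K} (hζ : ζ ^ 6 = 1) (hξ : ξ ^ 6 = 1)
    (h : Ideal.Quotient.mk 𝔭 ζ = Ideal.Quotient.mk 𝔭 ξ) : ζ = ξ := by
  obtain ⟨i, hi, rfl⟩ := isPrimitiveRoot_omega.eq_pow_of_pow_eq_one hζ
  obtain ⟨j, hj, rfl⟩ := isPrimitiveRoot_omega.eq_pow_of_pow_eq_one hξ
  rw [map_pow, map_pow] at h
  rw [h𝔭.isPrimitiveRoot_mk.pow_inj hi hj h]

theorem primeResidueSymbol_spec {n : ℕ} (hn : n ∣ 6) {α : 𝓞 K} (hα : α ∉ 𝔭) :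
    primeResidueSymbol n α 𝔭 ^ n = 1 ∧ Ideal.Quotient.mk 𝔭 (primeResidueSymbol n α 𝔭) =
      Ideal.Quotient.mk 𝔭 α ^ ((Ideal.absNorm 𝔭 - 1) / n) := by
  have := h𝔭.isPrime
  have h : ∃ ζ : 𝓞 K, ζ ^ n = 1 ∧
      (Ideal.Quotient.mk 𝔭 ζ) = (Ideal.Quotient.mk 𝔭 α) ^ ((Ideal.absNorm 𝔭 - 1) / n) := by
    have h1 : (Ideal.Quotient.mk 𝔭 α ^ ((Ideal.absNorm 𝔭 - 1) / n)) ^ n = 1 := by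
      rw [← pow_mul, Nat.div_mul_cancel (hn.trans h𝔭.six_dvd), h𝔭.pow_absNorm_sub_one hα]
    obtain ⟨i, -, hi⟩ := h𝔭.isPrimitiveRoot_mk.eq_pow_of_pow_eq_one
      (ξ := Ideal.Quotient.mk 𝔭 α ^ ((Ideal.absNorm 𝔭 - 1) / n)) (by
        obtain ⟨c, hc⟩ := hn
        rw [hc, pow_mul, h1, one_pow])
    refine ⟨omega ^ i, ?_, by rw [map_pow, hi]⟩
    rw [← pow_mul, isPrimitiveRoot_omega.pow_eq_one_iff_dvd]
    rw [← hi, ← pow_mul, h𝔭.isPrimitiveRoot_mk.pow_eq_one_iff_dvd] at h1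
    exact h1
  unfold primeResidueSymbol
  rw [dif_pos h]
  exact h.choose_spec

theorem primeResidueSymbol_eq {n : ℕ} (hn : n ∣ 6) {α ζ : 𝓞 K} (hα : α ∉ 𝔭) (hζ : ζ ^ n = 1)
    (h : Ideal.Quotient.mk 𝔭 ζ = Ideal.Quotient.mk 𝔭 α ^ ((Ideal.absNorm 𝔭 - 1) / n)) :
    primeResidueSymbol n α 𝔭 = ζ := by
  obtain ⟨h1, h2⟩ := h𝔭.primeResidueSymbol_spec hn hα
  obtain ⟨c, hc⟩ := hn
  exact h𝔭.eq_of_mk_eq (by rw [hc, pow_mul, h1, one_pow]) (by rw [hc, pow_mul, hζ, one_pow])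
    (h2.trans h.symm)

theorem primeResidueSymbol_mul {α β : 𝓞 K} (hα : α ∉ 𝔭) (hβ : β ∉ 𝔭) :
    primeResidueSymbol 6 (α * β) 𝔭 = primeResidueSymbol 6 α 𝔭 * primeResidueSymbol 6 β 𝔭 := by
  obtain ⟨h1, h2⟩ := h𝔭.primeResidueSymbol_spec dvd_rfl hα
  obtain ⟨h3, h4⟩ := h𝔭.primeResidueSymbol_spec dvd_rfl hβ
  refine h𝔭.primeResidueSymbol_eq dvd_rfl (fun h => (h𝔭.isPrime.mem_or_mem h).elim hα hβ) ?_ ?_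
  · rw [mul_pow, h1, h3, one_mul]
  · rw [map_mul, h2, h4, map_mul, mul_pow]

theorem primeResidueSymbol_three {α : 𝓞 K} (hα : α ∉ 𝔭) :
    primeResidueSymbol 3 α 𝔭 = primeResidueSymbol 6 α 𝔭 ^ 2 := by
  obtain ⟨h1, h2⟩ := h𝔭.primeResidueSymbol_spec dvd_rfl hα
  refine h𝔭.primeResidueSymbol_eq (by norm_num) hα (by rw [← pow_mul, h1]) ?_
  rw [map_pow, h2, ← pow_mul]
  congr 1
  have := h𝔭.six_dvd
  omega

theorem exists_pow_eq_mk_omega :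
    ∃ α : 𝓞 K, α ∉ 𝔭 ∧ Ideal.Quotient.mk 𝔭 α ^ ((Ideal.absNorm 𝔭 - 1) / 6) =
      Ideal.Quotient.mk 𝔭 omega := by
  have := h𝔭.isMaximal
  have := h𝔭.finite_quotient
  let := Ideal.Quotient.field 𝔭
  obtain ⟨a, ha0, ha⟩ := exists_pow_card_sub_one_div_eq (F := 𝓞 K ⧸ 𝔭)
    (absNorm_eq_card 𝔭 ▸ h𝔭.six_dvd) h𝔭.isPrimitiveRoot_mk.pow_eq_one (by norm_num)
  obtain ⟨α, rfl⟩ := Ideal.Quotient.mk_surjective a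
  refine ⟨α, fun h => ha0 (Ideal.Quotient.eq_zero_iff_mem.mpr h), ?_⟩
  rw [absNorm_eq_card]
  exact ha

theorem card_units_quotient : Nat.card (𝓞 K ⧸ 𝔭)ˣ = Ideal.absNorm 𝔭 - 1 := by
  have := h𝔭.isMaximal
  let := Ideal.Quotient.field 𝔭
  rw [absNorm_eq_card]
  exact Nat.card_units (𝓞 K ⧸ 𝔭)

end PrimeToSix

/-! ### The sextic symbol as a character modulo an ideal -/

section Composite

variable {𝔎 : Ideal (𝓞 K)}

theorem notMem_of_isUnit_mk {α : 𝓞 K} (h : IsUnit (Ideal.Quotient.mk 𝔎 α)) {𝔭 : Ideal (𝓞 K)}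
    (hp : 𝔭 ∈ normalizedFactors 𝔎) (h𝔭 : PrimeToSix 𝔭) : α ∉ 𝔭 := by
  intro hα
  have hle : 𝔎 ≤ 𝔭 := Ideal.dvd_iff_le.mp (dvd_of_mem_normalizedFactors hp)
  have := h𝔭.isPrime
  have h1 := h.map (Ideal.Quotient.factor hle)
  rw [Ideal.Quotient.factor_mk, Ideal.Quotient.eq_zero_iff_mem.mpr hα] at h1
  exact not_isUnit_zero h1

theorem residueSymbol_mul (h : ∀ 𝔭 ∈ normalizedFactors 𝔎, PrimeToSix 𝔭) {α β : 𝓞 K}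
    (hα : IsUnit (Ideal.Quotient.mk 𝔎 α)) (hβ : IsUnit (Ideal.Quotient.mk 𝔎 β)) :
    residueSymbol 6 (α * β) 𝔎 = residueSymbol 6 α 𝔎 * residueSymbol 6 β 𝔎 := by
  unfold residueSymbol
  rw [← Multiset.prod_map_mul]
  exact congrArg _ (Multiset.map_congr rfl fun 𝔭 hp => (h 𝔭 hp).primeResidueSymbol_mul
    (notMem_of_isUnit_mk hα hp (h 𝔭 hp)) (notMem_of_isUnit_mk hβ hp (h 𝔭 hp)))

theorem residueSymbol_three (h : ∀ 𝔭 ∈ normalizedFactors 𝔎, PrimeToSix 𝔭) {α : 𝓞 K}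
    (hα : IsUnit (Ideal.Quotient.mk 𝔎 α)) :
    residueSymbol 3 α 𝔎 = residueSymbol 6 α 𝔎 ^ 2 := by
  unfold residueSymbol
  rw [← Multiset.prod_map_pow]
  exact congrArg _ (Multiset.map_congr rfl fun 𝔭 hp => (h 𝔭 hp).primeResidueSymbol_three
    (notMem_of_isUnit_mk hα hp (h 𝔭 hp)))

theorem residueSymbol_pow_six (h : ∀ 𝔭 ∈ normalizedFactors 𝔎, PrimeToSix 𝔭) {α : 𝓞 K}
    (hα : IsUnit (Ideal.Quotient.mk 𝔎 α)) : residueSymbol 6 α 𝔎 ^ 6 = 1 := by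
  unfold residueSymbol
  rw [← Multiset.prod_map_pow]
  refine Multiset.prod_eq_one fun x hx => ?_
  obtain ⟨𝔭, hp, rfl⟩ := Multiset.mem_map.mp hx
  exact ((h 𝔭 hp).primeResidueSymbol_spec dvd_rfl (notMem_of_isUnit_mk hα hp (h 𝔭 hp))).1

theorem residueSymbol_one (h : ∀ 𝔭 ∈ normalizedFactors 𝔎, PrimeToSix 𝔭) :
    residueSymbol 6 1 𝔎 = 1 := by
  unfold residueSymbol
  refine Multiset.prod_eq_one fun x hx => ?_
  obtain ⟨𝔭, hp, rfl⟩ := Multiset.mem_map.mp hx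
  exact (h 𝔭 hp).primeResidueSymbol_eq dvd_rfl (h 𝔭 hp).isPrime.one_notMem (one_pow _) (by simp)

/-- The sextic residue symbol modulo `𝔎` as a multiplicative character. -/
noncomputable def sexticChar (𝔎 : Ideal (𝓞 K)) (h : ∀ 𝔭 ∈ normalizedFactors 𝔎, PrimeToSix 𝔭) :
    MulChar (𝓞 K ⧸ 𝔎) (𝓞 K) where
  toFun x := open Classical in if IsUnit x then classSymbol 6 𝔎 x else 0
  map_one' := by
    rw [if_pos isUnit_one, ← map_one (Ideal.Quotient.mk 𝔎), classSymbol_mk, residueSymbol_one h]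
  map_mul' x y := by
    by_cases hx : IsUnit x
    · by_cases hy : IsUnit y
      · rw [if_pos hx, if_pos hy, if_pos (hx.mul hy)]
        obtain ⟨α, rfl⟩ := Ideal.Quotient.mk_surjective x
        obtain ⟨β, rfl⟩ := Ideal.Quotient.mk_surjective y
        rw [← map_mul, classSymbol_mk, classSymbol_mk, classSymbol_mk, residueSymbol_mul h hx hy]
      · rw [if_neg hy, if_neg (fun hxy => hy (isUnit_of_mul_isUnit_right hxy)), mul_zero]
    · rw [if_neg hx, if_neg (fun hxy => hx (isUnit_of_mul_isUnit_left hxy)), zero_mul]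
  map_nonunit' x hx := if_neg hx

variable (h : ∀ 𝔭 ∈ normalizedFactors 𝔎, PrimeToSix 𝔭)

theorem sexticChar_apply {x : 𝓞 K ⧸ 𝔎} (hx : IsUnit x) :
    sexticChar 𝔎 h x = classSymbol 6 𝔎 x := if_pos hx

theorem classSymbol_three {x : 𝓞 K ⧸ 𝔎} (hx : IsUnit x) :
    classSymbol 3 𝔎 x = sexticChar 𝔎 h x ^ 2 := by
  rw [sexticChar_apply h hx]
  obtain ⟨α, rfl⟩ := Ideal.Quotient.mk_surjective x
  rw [classSymbol_mk, classSymbol_mk, residueSymbol_three h hx]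

theorem sexticChar_pow_six : sexticChar 𝔎 h ^ 6 = 1 := by
  ext u
  rw [MulChar.pow_apply_coe, MulChar.one_apply_coe, sexticChar_apply h u.isUnit]
  obtain ⟨α, hα⟩ := Ideal.Quotient.mk_surjective (u : 𝓞 K ⧸ 𝔎)
  rw [← hα, classSymbol_mk, residueSymbol_pow_six h (hα ▸ u.isUnit)]

theorem ncard_typeOneClass [Fintype (𝓞 K ⧸ 𝔎)] (ζ : 𝓞 K) :
    (typeOneClass 𝔎 ζ 1).ncard = characterCount (sexticChar 𝔎 h) ζ := by
  rw [characterCount, ← Nat.card_coe_set_eq]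
  refine Nat.card_congr (Equiv.subtypeEquivRight fun x => ?_)
  change ((IsUnit (x * (1 - x)) ∧ classSymbol 6 𝔎 x = ζ) ∧ classSymbol 3 𝔎 (x * (1 - x)) = 1) ↔ _
  rw [and_assoc]
  refine and_congr_right fun hx => ?_
  rw [classSymbol_three h hx, sexticChar_apply h (isUnit_of_mul_isUnit_left hx)]

theorem ncard_typeOneSet [Fintype (𝓞 K ⧸ 𝔎)] (S : Finset (𝓞 K)) :
    (typeOneSet 𝔎 S 1).ncard = ∑ ζ ∈ S, characterCount (sexticChar 𝔎 h) ζ := by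
  unfold typeOneSet
  have := S.finite_toSet.ncard_biUnion (fun ζ _ => (typeOneClass 𝔎 ζ 1).toFinite)
    (fun ζ _ ξ _ hne => Set.disjoint_left.mpr fun x hx hx' => hne (hx.1.2.symm.trans hx'.1.2))
  rw [this, finsum_mem_coe_finset]
  exact Finset.sum_congr rfl fun ζ _ => ncard_typeOneClass h ζ

end Composite
end SexticCount

namespace SexticCount

open scoped NumberField
open UniqueFactorizationMonoid

/-! ### Ideals above a rational prime `k ≥ 5` -/

section Prime

variable {k : ℕ}

theorem intCast_mem_of_dvd {𝔭 : Ideal (𝓞 K)} (hk : (k : 𝓞 K) ∈ 𝔭) {a : ℤ} (h : (k : ℤ) ∣ a) :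
    (a : 𝓞 K) ∈ 𝔭 := by
  obtain ⟨c, rfl⟩ := h
  push_cast
  exact Ideal.mul_mem_right _ _ hk

theorem eq_top_of_intCast_mem (hk : k.Prime) {I : Ideal (𝓞 K)} (hkI : (k : 𝓞 K) ∈ I) {a : ℤ}
    (ha : (a : 𝓞 K) ∈ I) (hka : ¬ (k : ℤ) ∣ a) : I = ⊤ := by
  obtain ⟨u, v, huv⟩ := (Nat.prime_iff_prime_int.mp hk).coprime_iff_not_dvd.mpr hka
  rw [Ideal.eq_top_iff_one]
  have : (1 : 𝓞 K) = u * k + v * a := by exact_mod_cast huv.symm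
  rw [this]
  exact I.add_mem (I.mul_mem_left _ hkI) (I.mul_mem_left _ ha)

theorem dvd_of_intCast_mem (hk : k.Prime) {I : Ideal (𝓞 K)} (hI : I ≠ ⊤) (hkI : (k : 𝓞 K) ∈ I)
    {a : ℤ} (ha : (a : 𝓞 K) ∈ I) : (k : ℤ) ∣ a :=
  by_contra fun h => hI (eq_top_of_intCast_mem hk hkI ha h)

theorem natCast_mem_principal (k : ℕ) : (k : 𝓞 K) ∈ principal k := by
  rw [principal, Int.cast_natCast]
  exact Ideal.mem_span_singleton_self _

theorem primeToSix_of_mem (hk : k.Prime) (hk5 : 5 ≤ k) {𝔭 : Ideal (𝓞 K)} (h : 𝔭.IsPrime)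
    (hk𝔭 : (k : 𝓞 K) ∈ 𝔭) : PrimeToSix 𝔭 where
  isPrime := h
  ne_bot := by
    rintro rfl
    exact hk.ne_zero (by exact_mod_cast (Ideal.mem_bot.mp hk𝔭))
  six_notMem h6 := by
    have h1 : (k : ℤ) ∣ 6 := dvd_of_intCast_mem hk h.ne_top hk𝔭 (by exact_mod_cast h6)
    have h2 : k ∣ 2 * 3 := by exact_mod_cast h1
    rcases hk.dvd_mul.mp h2 with h | h <;> have := Nat.le_of_dvd (by norm_num) h <;> omega

theorem primeToSix_of_mem_normalizedFactors (hk : k.Prime) (hk5 : 5 ≤ k) :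
    ∀ 𝔭 ∈ normalizedFactors (principal k), PrimeToSix 𝔭 := by
  intro 𝔭 h𝔭
  refine primeToSix_of_mem hk hk5 (Ideal.isPrime_of_prime (prime_of_normalized_factor _ h𝔭)) ?_
  exact Ideal.dvd_iff_le.mp (dvd_of_mem_normalizedFactors h𝔭) (natCast_mem_principal k)

theorem natCast_notMem (hk : k.Prime) {𝔭 : Ideal (𝓞 K)} (h𝔭 : 𝔭 ≠ ⊤) (hk𝔭 : (k : 𝓞 K) ∈ 𝔭) {m : ℕ}
    (hm : ¬ k ∣ m) : (m : 𝓞 K) ∉ 𝔭 := by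
  intro h
  exact hm (by exact_mod_cast dvd_of_intCast_mem hk h𝔭 hk𝔭 (a := m) (by exact_mod_cast h))

theorem isUnit_mk_natCast (hk : k.Prime) {m : ℕ} (hm : ¬ k ∣ m) :
    IsUnit (Ideal.Quotient.mk (principal k) (m : 𝓞 K)) := by
  obtain ⟨u, v, huv⟩ := (Nat.prime_iff_prime_int.mp hk).coprime_iff_not_dvd.mpr
    (show ¬ (k : ℤ) ∣ (m : ℤ) by exact_mod_cast hm)
  refine IsUnit.of_mul_eq_one (Ideal.Quotient.mk _ (v : 𝓞 K)) ?_
  rw [← map_mul, ← map_one (Ideal.Quotient.mk _), Ideal.Quotient.eq]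
  have : (m : 𝓞 K) * v - 1 = -u * k := by
    have : (u : 𝓞 K) * k + v * m = 1 := by exact_mod_cast huv
    linear_combination this
  rw [this]
  exact Ideal.mul_mem_left _ _ (natCast_mem_principal k)

theorem dvd_natCast_pow_sub_one (hk : k.Prime) {m : ℕ} (hm : ¬ k ∣ m) :
    (k : ℤ) ∣ (m : ℤ) ^ (k - 1) - 1 := by
  have := Fact.mk hk
  rw [← ZMod.intCast_zmod_eq_zero_iff_dvd]
  push_cast
  rw [ZMod.pow_card_sub_one_eq_one (by rwa [Ne, ZMod.natCast_eq_zero_iff]), sub_self]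

/-! ### The inert case -/

section Inert

theorem isPrime_principal (hk : k.Prime) (hk5 : 5 ≤ k) (hk3 : k ≡ 2 [MOD 3]) :
    (principal k).IsPrime := by
  have hne : principal k ≠ ⊤ := by
    intro h
    have := absNorm_principal k
    rw [h, Ideal.absNorm_top] at this
    have := hk.one_lt
    nlinarith
  obtain ⟨𝔭, hmax, hle⟩ := Ideal.exists_le_maximal _ hne
  have h𝔭 : PrimeToSix 𝔭 := primeToSix_of_mem hk hk5 hmax.isPrime (hle (natCast_mem_principal k))
  obtain ⟨J, hJ⟩ := Ideal.dvd_iff_le.mpr hle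
  have hN := absNorm_principal k
  rw [hJ, map_mul] at hN
  have h6 := h𝔭.six_dvd
  obtain ⟨i, hi, hNi⟩ := (Nat.dvd_prime_pow hk).mp (Dvd.intro _ hN)
  have hk0 := hk.pos
  interval_cases i
  · rw [pow_zero, Ideal.absNorm_eq_one_iff] at hNi
    exact absurd hNi hmax.ne_top
  -- A prime of norm `k` would force `6 ∣ k - 1`, against `k ≡ 2` modulo 3.
  · rw [hNi, pow_one] at h6
    unfold Nat.ModEq at hk3
    omega
  · rw [hNi] at hN
    have : Ideal.absNorm J = 1 := Nat.eq_of_mul_eq_mul_left (pow_pos hk0 2) (by rw [hN, mul_one])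
    rw [hJ, Ideal.absNorm_eq_one_iff.mp this, Ideal.mul_top]
    exact hmax.isPrime

theorem residueSymbol_principal (hk : k.Prime) (hk5 : 5 ≤ k) (hk3 : k ≡ 2 [MOD 3]) (α : 𝓞 K) :
    residueSymbol 6 α (principal k) = primeResidueSymbol 6 α (principal k) := by
  have h := primeToSix_of_mem hk hk5 (isPrime_principal hk hk5 hk3) (natCast_mem_principal k)
  have h1 : Prime (principal k) := Ideal.prime_of_isPrime h.ne_bot h.isPrime
  rw [residueSymbol, normalizedFactors_irreducible h1.irreducible, normalize_eq]
  simp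

/-- Here `6 ∣ k + 1`, so the exponent `(k^2 - 1)/6` is a multiple of `k - 1` and Fermat's little
theorem applies. -/
theorem residueSymbol_natCast_of_inert (hk : k.Prime) (hk5 : 5 ≤ k) (hk3 : k ≡ 2 [MOD 3]) {m : ℕ}
    (hm : ¬ k ∣ m) : residueSymbol 6 (m : 𝓞 K) (principal k) = 1 := by
  have h := primeToSix_of_mem hk hk5 (isPrime_principal hk hk5 hk3) (natCast_mem_principal k)
  rw [residueSymbol_principal hk hk5 hk3]
  refine h.primeResidueSymbol_eq dvd_rfl
    (natCast_notMem hk h.isPrime.ne_top (natCast_mem_principal k) hm) (one_pow _) ?_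
  have h1 : Ideal.Quotient.mk (principal k) (m : 𝓞 K) ^ (k - 1) = 1 := by
    rw [← map_pow, ← map_one (Ideal.Quotient.mk _), Ideal.Quotient.eq]
    exact_mod_cast intCast_mem_of_dvd (natCast_mem_principal k) (dvd_natCast_pow_sub_one hk hm)
  have h2 : (k ^ 2 - 1) / 6 = (k - 1) * ((k + 1) / 6) := by
    have h3 : 6 ∣ k + 1 := by
      have := hk.eq_two_or_odd
      unfold Nat.ModEq at hk3
      omega
    rw [← Nat.mul_div_assoc _ h3, mul_comm (k - 1), ← Nat.sq_sub_sq, one_pow]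
  rw [absNorm_principal, h2, pow_mul, h1, one_pow, map_one]

theorem card_units_of_inert (hk : k.Prime) (hk5 : 5 ≤ k) (hk3 : k ≡ 2 [MOD 3]) :
    Nat.card (𝓞 K ⧸ principal k)ˣ = k ^ 2 - 1 := by
  have h := primeToSix_of_mem hk hk5 (isPrime_principal hk hk5 hk3) (natCast_mem_principal k)
  rw [h.card_units_quotient, absNorm_principal]

theorem exists_residueSymbol_eq_of_inert (hk : k.Prime) (hk5 : 5 ≤ k) (hk3 : k ≡ 2 [MOD 3]) :
    ∃ α : 𝓞 K, IsUnit (Ideal.Quotient.mk (principal k) α) ∧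
      residueSymbol 6 α (principal k) = omega := by
  have h := primeToSix_of_mem hk hk5 (isPrime_principal hk hk5 hk3) (natCast_mem_principal k)
  obtain ⟨α, hα, hα'⟩ := h.exists_pow_eq_mk_omega
  refine ⟨α, ?_, ?_⟩
  · have := h.isMaximal
    let := Ideal.Quotient.field (principal k)
    exact IsUnit.mk0 _ (fun h => hα (Ideal.Quotient.eq_zero_iff_mem.mp h))
  · rw [residueSymbol_principal hk hk5 hk3]
    exact h.primeResidueSymbol_eq dvd_rfl hα isPrimitiveRoot_omega.pow_eq_one hα'.symm

end Inert

/-! ### The split case -/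

section Split

/-- The ideal `(k, ω - r)`. -/
noncomputable def splitIdeal (k : ℕ) (r : ℤ) : Ideal (𝓞 K) := Ideal.span {(k : 𝓞 K), omega - r}

theorem natCast_mem_splitIdeal (k : ℕ) (r : ℤ) : (k : 𝓞 K) ∈ splitIdeal k r :=
  Ideal.subset_span (by simp)

theorem omega_sub_mem_splitIdeal (k : ℕ) (r : ℤ) : omega - r ∈ splitIdeal k r :=
  Ideal.subset_span (by simp)

theorem exists_dvd_sq_sub_add_one (hk : k.Prime) (hk3 : k ≡ 1 [MOD 3]) :
    ∃ r : ℤ, (k : ℤ) ∣ r ^ 2 - r + 1 := by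
  have := Fact.mk hk
  have := Fact.mk Nat.prime_three
  have h3 : 3 ∣ Nat.card (ZMod k)ˣ := by
    rw [Nat.card_units, Nat.card_zmod]
    exact (Nat.modEq_iff_dvd' hk.one_le).mp hk3.symm
  obtain ⟨y, hy⟩ := exists_prime_orderOf_dvd_card' 3 h3
  have hy1 : (y : ZMod k) - 1 ≠ 0 := by
    intro h
    have : y = 1 := Units.ext (by simpa using sub_eq_zero.mp h)
    rw [this, orderOf_one] at hy
    norm_num at hy
  have hy3 : (y : ZMod k) ^ 3 = 1 := by
    rw [← Units.val_pow_eq_pow_val, ← hy, pow_orderOf_eq_one, Units.val_one]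
  -- The negative of an element of order 3 is a root of `X^2 - X + 1`, the minimal polynomial of
  -- `ω`.
  refine ⟨-((y : ZMod k).val : ℤ), ?_⟩
  rw [← ZMod.intCast_zmod_eq_zero_iff_dvd]
  push_cast
  rw [ZMod.natCast_zmod_val]
  apply mul_left_cancel₀ hy1
  linear_combination hy3

variable {r : ℤ}

theorem not_dvd_one_sub_two_mul (hk5 : 5 ≤ k) (hr : (k : ℤ) ∣ r ^ 2 - r + 1) :
    ¬ (k : ℤ) ∣ 1 - 2 * r := by
  intro h
  have h1 : (k : ℤ) ∣ 3 := by
    -- The discriminant identity `4(r^2 - r + 1) - (1 - 2r)^2 = 3`.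
    have h2 := dvd_sub (hr.mul_left 4) (h.mul_left (1 - 2 * r))
    ring_nf at h2
    exact h2
  have := Int.le_of_dvd (by norm_num) h1
  omega

theorem splitIdeal_mul (hk : k.Prime) (hk5 : 5 ≤ k) (hr : (k : ℤ) ∣ r ^ 2 - r + 1) :
    splitIdeal k r * splitIdeal k (1 - r) = principal k := by
  apply le_antisymm
  · rw [splitIdeal, splitIdeal, Ideal.span_pair_mul_span_pair, Ideal.span_le]
    have hkk := natCast_mem_principal k
    rintro x (rfl | rfl | rfl | rfl)
    · exact Ideal.mul_mem_left _ _ hkk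
    · exact Ideal.mul_mem_right _ _ hkk
    · exact Ideal.mul_mem_left _ _ hkk
    · have : (omega - (r : 𝓞 K)) * (omega - ((1 - r : ℤ) : 𝓞 K)) =
          -((r ^ 2 - r + 1 : ℤ) : 𝓞 K) := by
        push_cast
        linear_combination omega_sq
      rw [this]
      exact neg_mem (intCast_mem_of_dvd hkk hr)
  · rw [principal, Ideal.span_singleton_le_iff_mem, Int.cast_natCast]
    -- The product ideal contains `k^2` and `k(1 - 2r)`; a Bézout relation between `k` and `1 - 2r`
    -- recovers `k`.
    obtain ⟨u, v, huv⟩ := (Nat.prime_iff_prime_int.mp hk).coprime_iff_not_dvd.mpr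
      (not_dvd_one_sub_two_mul hk5 hr)
    have huv' : (u : 𝓞 K) * k + v * (1 - 2 * r) = 1 := by exact_mod_cast huv
    have h : (k : 𝓞 K) = u * (k * k) + v * ((omega - r) * k - k * (omega - (1 - r : ℤ))) := by
      push_cast
      linear_combination -(k : 𝓞 K) * huv'
    rw [h]
    have h1 := natCast_mem_splitIdeal k r
    have h2 := natCast_mem_splitIdeal k (1 - r)
    exact add_mem (Ideal.mul_mem_left _ _ (Ideal.mul_mem_mul h1 h2)) (Ideal.mul_mem_left _ _
      (sub_mem (Ideal.mul_mem_mul (omega_sub_mem_splitIdeal k r) h2)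
        (Ideal.mul_mem_mul h1 (omega_sub_mem_splitIdeal k (1 - r)))))

theorem dvd_one_sub (hr : (k : ℤ) ∣ r ^ 2 - r + 1) : (k : ℤ) ∣ (1 - r) ^ 2 - (1 - r) + 1 := by
  convert hr using 1
  ring

theorem splitIdeal_ne_top (hk : k.Prime) (hk5 : 5 ≤ k) (hr : (k : ℤ) ∣ r ^ 2 - r + 1) :
    splitIdeal k r ≠ ⊤ := by
  intro h
  have h1 := splitIdeal_mul hk hk5 hr
  rw [h, Ideal.top_mul] at h1
  exact omega_sub_intCast_notMem hk _ (h1 ▸ omega_sub_mem_splitIdeal k (1 - r))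

theorem absNorm_splitIdeal (hk : k.Prime) (hk5 : 5 ≤ k) (hr : (k : ℤ) ∣ r ^ 2 - r + 1) :
    Ideal.absNorm (splitIdeal k r) = k := by
  have h := absNorm_principal k
  rw [← splitIdeal_mul hk hk5 hr, map_mul] at h
  exact ((Nat.Prime.mul_eq_prime_sq_iff hk
    (fun h => splitIdeal_ne_top hk hk5 hr (Ideal.absNorm_eq_one_iff.mp h))
    (fun h => splitIdeal_ne_top hk hk5 (dvd_one_sub hr) (Ideal.absNorm_eq_one_iff.mp h))).mp h).1

theorem primeToSix_splitIdeal (hk : k.Prime) (hk5 : 5 ≤ k) (hr : (k : ℤ) ∣ r ^ 2 - r + 1) :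
    PrimeToSix (splitIdeal k r) :=
  primeToSix_of_mem hk hk5 (Ideal.isPrime_of_irreducible_absNorm
    (by rw [absNorm_splitIdeal hk hk5 hr]; exact hk)) (natCast_mem_splitIdeal k r)

theorem isCoprime_splitIdeal (hk : k.Prime) (hk5 : 5 ≤ k) (hr : (k : ℤ) ∣ r ^ 2 - r + 1) :
    IsCoprime (splitIdeal k r) (splitIdeal k (1 - r)) := by
  rw [Ideal.isCoprime_iff_sup_eq]
  refine eq_top_of_intCast_mem hk (Ideal.mem_sup_left (natCast_mem_splitIdeal k r)) (a := 1 - 2 * r)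
    ?_ (not_dvd_one_sub_two_mul hk5 hr)
  have : ((1 - 2 * r : ℤ) : 𝓞 K) = (omega - r) - (omega - (1 - r : ℤ)) := by
    push_cast; ring
  rw [this]
  exact sub_mem (Ideal.mem_sup_left (omega_sub_mem_splitIdeal k r))
    (Ideal.mem_sup_right (omega_sub_mem_splitIdeal k (1 - r)))

theorem residueSymbol_of_split (hk : k.Prime) (hk5 : 5 ≤ k) (hr : (k : ℤ) ∣ r ^ 2 - r + 1)
    (α : 𝓞 K) : residueSymbol 6 α (principal k) =
      primeResidueSymbol 6 α (splitIdeal k r) * primeResidueSymbol 6 α (splitIdeal k (1 - r)) := by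
  have h1 := primeToSix_splitIdeal hk hk5 hr
  have h2 := primeToSix_splitIdeal hk hk5 (dvd_one_sub hr)
  have h3 : Prime (splitIdeal k r) := Ideal.prime_of_isPrime h1.ne_bot h1.isPrime
  have h4 : Prime (splitIdeal k (1 - r)) := Ideal.prime_of_isPrime h2.ne_bot h2.isPrime
  rw [residueSymbol, ← splitIdeal_mul hk hk5 hr, normalizedFactors_mul h3.ne_zero h4.ne_zero,
    normalizedFactors_irreducible h3.irreducible, normalizedFactors_irreducible h4.irreducible,
    normalize_eq, normalize_eq]
  simp

/-- The symbols of an integer at the two conjugate primes are conjugate, so their product is 1.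
Concretely, `ω` modulo the first prime and `ω^5 = 1 - ω` modulo the second are the same integer `r`;
a symbol `ω^i` at the first becomes `(ω^5)^i` at the second. -/
theorem residueSymbol_natCast_of_split (hk : k.Prime) (hk5 : 5 ≤ k)
    (hr : (k : ℤ) ∣ r ^ 2 - r + 1) {m : ℕ} (hm : ¬ k ∣ m) :
    residueSymbol 6 (m : 𝓞 K) (principal k) = 1 := by
  have h1 := primeToSix_splitIdeal hk hk5 hr
  have h2 := primeToSix_splitIdeal hk hk5 (dvd_one_sub hr)
  have hk1 := natCast_mem_splitIdeal k r
  have hk2 := natCast_mem_splitIdeal k (1 - r)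
  obtain ⟨h3, h4⟩ := h1.primeResidueSymbol_spec dvd_rfl
    (natCast_notMem hk h1.isPrime.ne_top hk1 hm)
  obtain ⟨i, -, hi⟩ := isPrimitiveRoot_omega.eq_pow_of_pow_eq_one h3
  rw [absNorm_splitIdeal hk hk5 hr] at h4
  have hω1 : Ideal.Quotient.mk (splitIdeal k r) omega = Ideal.Quotient.mk _ (r : 𝓞 K) :=
    Ideal.Quotient.eq.mpr (omega_sub_mem_splitIdeal k r)
  have hω2 : Ideal.Quotient.mk (splitIdeal k (1 - r)) (omega ^ 5) =
      Ideal.Quotient.mk _ (r : 𝓞 K) := by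
    rw [Ideal.Quotient.eq]
    have : omega ^ 5 - (r : 𝓞 K) = -(omega - (1 - r : ℤ)) := by
      push_cast
      linear_combination (omega ^ 3 + omega ^ 2 - 1) * omega_sq
    rw [this]
    exact neg_mem (omega_sub_mem_splitIdeal k (1 - r))
  have hdvd : (k : ℤ) ∣ r ^ i - (m : ℤ) ^ ((k - 1) / 6) := by
    refine dvd_of_intCast_mem hk h1.isPrime.ne_top hk1 ?_
    rw [← hi, map_pow, hω1, ← map_pow, ← map_pow, Ideal.Quotient.eq] at h4
    exact_mod_cast h4
  have h5 : primeResidueSymbol 6 (m : 𝓞 K) (splitIdeal k (1 - r)) = (omega ^ 5) ^ i := by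
    refine h2.primeResidueSymbol_eq dvd_rfl (natCast_notMem hk h2.isPrime.ne_top hk2 hm) ?_ ?_
    · rw [← pow_mul, ← pow_mul, show 5 * (i * 6) = 6 * (5 * i) by ring, pow_mul,
        isPrimitiveRoot_omega.pow_eq_one, one_pow]
    · rw [absNorm_splitIdeal hk hk5 (dvd_one_sub hr), map_pow, hω2, ← map_pow, ← map_pow,
        Ideal.Quotient.eq]
      exact_mod_cast intCast_mem_of_dvd hk2 hdvd
  rw [residueSymbol_of_split hk hk5 hr, h5, ← hi, ← mul_pow, ← pow_succ',
    isPrimitiveRoot_omega.pow_eq_one, one_pow]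

/-- The Chinese remainder isomorphism modulo a split prime. -/
noncomputable def splitEquiv (hk : k.Prime) (hk5 : 5 ≤ k) (hr : (k : ℤ) ∣ r ^ 2 - r + 1) :
    𝓞 K ⧸ principal k ≃+* (𝓞 K ⧸ splitIdeal k r) × (𝓞 K ⧸ splitIdeal k (1 - r)) :=
  (Ideal.quotEquivOfEq (splitIdeal_mul hk hk5 hr).symm).trans
    (Ideal.quotientMulEquivQuotientProd _ _ (isCoprime_splitIdeal hk hk5 hr))

theorem splitEquiv_mk (hk : k.Prime) (hk5 : 5 ≤ k) (hr : (k : ℤ) ∣ r ^ 2 - r + 1) (α : 𝓞 K) :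
    splitEquiv hk hk5 hr (Ideal.Quotient.mk _ α) =
      (Ideal.Quotient.mk _ α, Ideal.Quotient.mk _ α) := rfl

theorem card_units_of_split (hk : k.Prime) (hk5 : 5 ≤ k) (hr : (k : ℤ) ∣ r ^ 2 - r + 1) :
    Nat.card (𝓞 K ⧸ principal k)ˣ = (k - 1) * (k - 1) := by
  rw [Nat.card_congr ((Units.mapEquiv (splitEquiv hk hk5 hr).toMulEquiv).trans
    MulEquiv.prodUnits).toEquiv, Nat.card_prod,
    (primeToSix_splitIdeal hk hk5 hr).card_units_quotient,
    (primeToSix_splitIdeal hk hk5 (dvd_one_sub hr)).card_units_quotient,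
    absNorm_splitIdeal hk hk5 hr, absNorm_splitIdeal hk hk5 (dvd_one_sub hr)]

/-- The Chinese remainder theorem allows symbol `ω` at one prime and residue 1 at the other. -/
theorem exists_residueSymbol_eq_of_split (hk : k.Prime) (hk5 : 5 ≤ k)
    (hr : (k : ℤ) ∣ r ^ 2 - r + 1) :
    ∃ α : 𝓞 K, IsUnit (Ideal.Quotient.mk (principal k) α) ∧
      residueSymbol 6 α (principal k) = omega := by
  have h1 := primeToSix_splitIdeal hk hk5 hr
  have h2 := primeToSix_splitIdeal hk hk5 (dvd_one_sub hr)
  obtain ⟨β, hβ, hβ'⟩ := h1.exists_pow_eq_mk_omega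
  obtain ⟨x, hx⟩ := (splitEquiv hk hk5 hr).surjective (Ideal.Quotient.mk _ β, 1)
  obtain ⟨α, rfl⟩ := Ideal.Quotient.mk_surjective x
  rw [splitEquiv_mk, Prod.mk.injEq] at hx
  obtain ⟨hα1, hα2⟩ := hx
  have hu1 : IsUnit (Ideal.Quotient.mk (splitIdeal k r) α) := by
    have := h1.isMaximal
    let := Ideal.Quotient.field (splitIdeal k r)
    rw [hα1]
    exact IsUnit.mk0 _ (fun h => hβ (Ideal.Quotient.eq_zero_iff_mem.mp h))
  refine ⟨α, ?_, ?_⟩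
  · rw [← MulEquiv.isUnit_map (splitEquiv hk hk5 hr), splitEquiv_mk, Prod.isUnit_iff]
    exact ⟨hu1, hα2 ▸ isUnit_one⟩
  · rw [residueSymbol_of_split hk hk5 hr, h1.primeResidueSymbol_eq dvd_rfl (ζ := omega),
      h2.primeResidueSymbol_eq dvd_rfl (ζ := 1), mul_one]
    · intro h
      rw [Ideal.Quotient.eq_zero_iff_mem.mpr h] at hα2
      have := h2.isPrime
      exact zero_ne_one hα2
    · exact one_pow _
    · rw [hα2, one_pow, map_one]
    · intro h
      rw [Ideal.Quotient.eq_zero_iff_mem.mpr h] at hα1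
      exact hβ (Ideal.Quotient.eq_zero_iff_mem.mp hα1.symm)
    · exact isPrimitiveRoot_omega.pow_eq_one
    · rw [hα1, hβ']

end Split

/-! ### Assembling the counts -/

/-- Eighteen times the number of classes counted for the sextic symbol `ζ`, for a prime `k` such that
the integers prime to `k` have trivial symbol and `𝓞 K / k` has `(k - 1) (k - e)` units. -/
theorem characterCount_principal (hk : k.Prime) (hk5 : 5 ≤ k) {e : ℤ}
    [Fintype (𝓞 K ⧸ principal k)]
    (he : (Nat.card (𝓞 K ⧸ principal k)ˣ : ℤ) = ((k : ℤ) - 1) * (k - e))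
    (hint : ∀ m : ℕ, ¬ k ∣ m → residueSymbol 6 (m : 𝓞 K) (principal k) = 1)
    (hom : ∃ α : 𝓞 K, IsUnit (Ideal.Quotient.mk (principal k) α) ∧
      residueSymbol 6 α (principal k) = omega) {ζ ξ : 𝓞 K} (hζ : ζ ^ 6 = 1) (hξ : ζ * ξ = 1) :
    18 * (characterCount (sexticChar _ (primeToSix_of_mem_normalizedFactors hk hk5)) ζ : 𝓞 K) =
      ((k - e - 1) ^ 2 + e - 1 + 2 * k)
      + (ξ + ξ ^ 3 + ξ ^ 5) * (e + 2 * k) + (ξ ^ 2 + ξ ^ 4) * (3 * e) := by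
  have := Fact.mk hk
  have hcard : Fintype.card (𝓞 K ⧸ principal k) = k ^ 2 := by
    rw [← Nat.card_eq_fintype_card, ← absNorm_eq_card, absNorm_principal]
  have hnt := Fintype.one_lt_card_iff_nontrivial.mp
    (show 1 < Fintype.card (𝓞 K ⧸ principal k) by
      rw [hcard]; exact Nat.one_lt_pow two_ne_zero hk.one_lt)
  have : CharP (𝓞 K ⧸ principal k) k := by
    refine (CharP.charP_iff_prime_eq_zero hk).mpr ?_
    rw [← map_natCast (Ideal.Quotient.mk (principal k)), Ideal.Quotient.eq_zero_iff_mem]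
    exact natCast_mem_principal k
  let := ZMod.algebra (𝓞 K ⧸ principal k) k
  refine characterCount_eq (p := k) hcard (by exact_mod_cast congrArg (Int.cast (R := 𝓞 K)) he)
    ?_ (sexticChar_pow_six _) isPrimitiveRoot_omega ?_ hζ hξ
  · intro t ht
    have h1 : ¬ k ∣ t.val := by
      rw [← ZMod.natCast_eq_zero_iff, ZMod.natCast_zmod_val]
      exact ht
    rw [← ZMod.natCast_zmod_val t, map_natCast, ← map_natCast (Ideal.Quotient.mk (principal k)),
      sexticChar_apply _ (isUnit_mk_natCast hk h1), classSymbol_mk, hint _ h1]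
  · obtain ⟨α, hα, hα'⟩ := hom
    exact ⟨_, by rw [sexticChar_apply _ hα, classSymbol_mk, hα']⟩

theorem countTypeOne_image_range (hk : k.Prime) (hk5 : 5 ≤ k) [Fintype (𝓞 K ⧸ principal k)]
    {J : Finset ℕ} (hJ : J ⊆ Finset.range 6) {S : Set (𝓞 K)} (hS : S = (omega ^ ·) '' (J : Set ℕ)) :
    countTypeOne k S = ∑ j ∈ J,
      characterCount (sexticChar _ (primeToSix_of_mem_normalizedFactors hk hk5)) (omega ^ j) := by
  classical
  have hinj : Set.InjOn (omega ^ ·) (J : Set ℕ) := fun i hi j hj h =>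
    isPrimitiveRoot_omega.pow_inj (Finset.mem_range.mp (hJ hi)) (Finset.mem_range.mp (hJ hj)) h
  rw [countTypeOne, hS, ← Finset.coe_image,
    ncard_typeOneSet (primeToSix_of_mem_normalizedFactors hk hk5), Finset.sum_image hinj]

theorem muSix_eq : muSix = (omega ^ ·) '' (Finset.range 6 : Set ℕ) := by
  ext ζ
  constructor
  · intro h
    obtain ⟨i, hi, rfl⟩ := isPrimitiveRoot_omega.eq_pow_of_pow_eq_one h
    exact ⟨i, by simpa using hi, rfl⟩
  · rintro ⟨i, -, rfl⟩
    change (omega ^ i) ^ 6 = 1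
    rw [← pow_mul, mul_comm, pow_mul, isPrimitiveRoot_omega.pow_eq_one, one_pow]

theorem countTypeOne_eq (hk : k.Prime) (hk5 : 5 ≤ k) {e : ℤ}
    (he : (Nat.card (𝓞 K ⧸ principal k)ˣ : ℤ) = ((k : ℤ) - 1) * (k - e))
    (hint : ∀ m : ℕ, ¬ k ∣ m → residueSymbol 6 (m : 𝓞 K) (principal k) = 1)
    (hom : ∃ α : 𝓞 K, IsUnit (Ideal.Quotient.mk (principal k) α) ∧
      residueSymbol 6 α (principal k) = omega) :
    9 * (countTypeOne k {omega, omega ^ 5} : ℤ) = (k - e) ^ 2 ∧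
    18 * (countTypeOne k {omega, omega ^ 3, omega ^ 5} : ℤ) =
      2 * (k - e) ^ 2 + ((k - e - 1) ^ 2 - 4 * k + 4 * e - 1) ∧
    9 * (countTypeOne k {omega, omega ^ 2, omega ^ 4, omega ^ 5} : ℤ) = 2 * (k - e) ^ 2 ∧
    3 * (countTypeOne k muSix : ℤ) = (k - e - 1) ^ 2 + e - 1 + 2 * k := by
  have hne : principal k ≠ ⊥ := fun h => hk.ne_zero (by
    exact_mod_cast Ideal.mem_bot.mp (h ▸ natCast_mem_principal k))
  have hfin : Finite (𝓞 K ⧸ principal k) := by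
    rw [← Ideal.absNorm_ne_zero_iff, absNorm_principal]
    exact pow_ne_zero 2 hk.ne_zero
  let := Fintype.ofFinite (𝓞 K ⧸ principal k)
  set N : ℕ → ℕ := fun j =>
    characterCount (sexticChar _ (primeToSix_of_mem_normalizedFactors hk hk5)) (omega ^ j) with hN
  have hω6 := isPrimitiveRoot_omega.pow_eq_one
  have key : ∀ i j : ℕ, i + j = 6 → 18 * (N i : 𝓞 K) =
      ((k - e - 1) ^ 2 + e - 1 + 2 * k) + (omega ^ j + (omega ^ j) ^ 3 + (omega ^ j) ^ 5) *
      (e + 2 * k) + ((omega ^ j) ^ 2 + (omega ^ j) ^ 4) * (3 * e) := by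
    intro i j hij
    refine characterCount_principal hk hk5 he hint hom ?_ ?_
    · rw [← pow_mul, mul_comm, pow_mul, hω6, one_pow]
    · rw [← pow_add, hij, hω6]
  have h3 : omega ^ 3 = -1 := by linear_combination (omega + 1) * omega_sq
  -- For `i` prime to 3, `ξ = ω^j` satisfies `ξ + ξ^3 + ξ^5 = 0` and `ξ^2 + ξ^4 = -1`, so all four
  -- such symbols have the same count. Only `i = 0` and `i = 3` need separate evaluation.
  have key' : ∀ i j : ℕ, i + j = 6 → (omega ^ j) ^ 4 + (omega ^ j) ^ 2 + 1 = 0 →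
      18 * (N i : ℤ) = (k - e) ^ 2 := by
    intro i j hij hj
    have : 18 * (N i : 𝓞 K) = (k - e) ^ 2 := by
      linear_combination key i j hij + (omega ^ j * (e + 2 * k) + 3 * e) * hj
    exact_mod_cast this
  have h24 : (omega ^ 1) ^ 4 + (omega ^ 1) ^ 2 + 1 = 0 := by
    linear_combination (omega ^ 2 + omega + 1) * omega_sq
  have k0 : 18 * (N 0 : ℤ) = ((k - e - 1) ^ 2 + e - 1 + 2 * k) + 3 * (e + 2 * k) + 6 * e := by
    have h := key 0 6 rfl
    simp only [hω6, one_pow] at h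
    have : 18 * (N 0 : 𝓞 K) =
        ((k - e - 1) ^ 2 + e - 1 + 2 * k) + 3 * (e + 2 * k) + 6 * e := by linear_combination h
    exact_mod_cast this
  have k1 := key' 1 5 rfl (by
    linear_combination h24 + (omega ^ 2 * (omega ^ 12 + omega ^ 6 + 1) + omega ^ 4) * hω6)
  have k2 := key' 2 4 rfl (by
    linear_combination (omega ^ 8 - omega ^ 4 + 1) * (omega ^ 4 - omega ^ 2 + 1) * h24)
  have k3 : 18 * (N 3 : ℤ) = ((k - e - 1) ^ 2 + e - 1 + 2 * k) - 3 * (e + 2 * k) + 6 * e := by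
    have h := key 3 3 rfl
    rw [h3] at h
    have : 18 * (N 3 : 𝓞 K) =
        ((k - e - 1) ^ 2 + e - 1 + 2 * k) - 3 * (e + 2 * k) + 6 * e := by linear_combination h
    exact_mod_cast this
  have k4 := key' 4 2 rfl (by linear_combination (omega ^ 4 - omega ^ 2 + 1) * h24)
  have k5 := key' 5 1 rfl h24
  have count := fun (J : Finset ℕ) (hJ : J ⊆ Finset.range 6) (S : Set (𝓞 K)) hS =>
    countTypeOne_image_range hk hk5 hJ (S := S) hS
  refine ⟨?_, ?_, ?_, ?_⟩
  · rw [count {1, 5} (by decide) _ (by simp [Set.image_insert_eq])]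
    simp only [Finset.sum_insert, Finset.mem_singleton, Finset.sum_singleton, Nat.reduceEqDiff,
      not_false_eq_true]
    push_cast
    linarith
  · rw [count {1, 3, 5} (by decide) _ (by simp [Set.image_insert_eq])]
    rw [Finset.sum_insert (by decide), Finset.sum_insert (by decide), Finset.sum_singleton]
    push_cast
    linarith
  · rw [count {1, 2, 4, 5} (by decide) _ (by simp [Set.image_insert_eq])]
    rw [Finset.sum_insert (by decide), Finset.sum_insert (by decide),
      Finset.sum_insert (by decide), Finset.sum_singleton]
    push_cast
    linarith
  · rw [count (Finset.range 6) subset_rfl _ muSix_eq]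
    simp only [Finset.sum_range_succ, Finset.sum_range_zero]
    push_cast
    linarith

end Prime
end SexticCount

open SexticCount in
theorem proposition37 (k : ℕ) (hk : k.Prime) (hk5 : 5 ≤ k) :
    (k ≡ 1 [MOD 3] →
      (countTypeOne k {omega, omega ^ 5} : ℚ) = (1 / 9) * ((k : ℚ) - 1) ^ 2 ∧
      (countTypeOne k {omega, omega ^ 3, omega ^ 5} : ℚ)
        = (1 / 6) * ((k : ℚ) - 1) * ((k : ℚ) - 3) ∧
      (countTypeOne k {omega, omega ^ 2, omega ^ 4, omega ^ 5} : ℚ)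
        = (2 / 9) * ((k : ℚ) - 1) ^ 2 ∧
      (countTypeOne k muSix : ℚ) = (1 / 3) * ((k : ℚ) ^ 2 - 2 * k + 4)) ∧
    (k ≡ 2 [MOD 3] →
      (countTypeOne k {omega, omega ^ 5} : ℚ) = (1 / 9) * ((k : ℚ) + 1) ^ 2 ∧
      (countTypeOne k {omega, omega ^ 3, omega ^ 5} : ℚ)
        = (1 / 6) * ((k : ℚ) ^ 2 - 1) ∧
      (countTypeOne k {omega, omega ^ 2, omega ^ 4, omega ^ 5} : ℚ)
        = (2 / 9) * ((k : ℚ) + 1) ^ 2 ∧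
      (countTypeOne k muSix : ℚ) = (1 / 3) * ((k : ℚ) ^ 2 + 2 * k - 2)) := by
  constructor
  · intro hk3
    obtain ⟨r, hr⟩ := exists_dvd_sq_sub_add_one hk hk3
    have hk1 : ((k - 1 : ℕ) : ℤ) = k - 1 := by rw [Nat.cast_sub hk.one_le, Nat.cast_one]
    -- Split: two residue fields of order `k`, hence `(k - 1)(k - 1)` units.
    obtain ⟨ha, hb, hc, hd⟩ := countTypeOne_eq hk hk5 (e := 1)
      (by rw [card_units_of_split hk hk5 hr, Nat.cast_mul, hk1])
      (fun m hm => residueSymbol_natCast_of_split hk hk5 hr hm)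
      (exists_residueSymbol_eq_of_split hk hk5 hr)
    have ha' := congrArg (Int.cast (R := ℚ)) ha
    have hb' := congrArg (Int.cast (R := ℚ)) hb
    have hc' := congrArg (Int.cast (R := ℚ)) hc
    have hd' := congrArg (Int.cast (R := ℚ)) hd
    push_cast at ha' hb' hc' hd'
    refine ⟨?_, ?_, ?_, ?_⟩ <;> linarith
  · intro hk3
    have hk1 : ((k ^ 2 - 1 : ℕ) : ℤ) = (k : ℤ) ^ 2 - 1 := by
      rw [Nat.cast_sub (Nat.one_le_pow _ _ hk.pos), Nat.cast_one, Nat.cast_pow]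
    -- Inert: one residue field of order `k^2`, hence `(k - 1)(k + 1)` units.
    obtain ⟨ha, hb, hc, hd⟩ := countTypeOne_eq hk hk5 (e := -1)
      (by rw [card_units_of_inert hk hk5 hk3, hk1]; ring)
      (fun m hm => residueSymbol_natCast_of_inert hk hk5 hk3 hm)
      (exists_residueSymbol_eq_of_inert hk hk5 hk3)
    have ha' := congrArg (Int.cast (R := ℚ)) ha
    have hb' := congrArg (Int.cast (R := ℚ)) hb
    have hc' := congrArg (Int.cast (R := ℚ)) hc
    have hd' := congrArg (Int.cast (R := ℚ)) hd
    push_cast at ha' hb' hc' hd'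
    refine ⟨?_, ?_, ?_, ?_⟩ <;> linarith
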